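/- **Theorem (Preservation for $F_{<:C}$).** Let $\Gamma$ be an environment, $s,t$ terms and $T$ a qualified type of the calculus $F_{<:C}$ defined below. If $\Gamma\vdash s:T$ and $s\longrightarrow t$, then $\Gamma\vdash t:T$. *Syntax* (up to renaming of bound variables; $x$ ranges over term variables, $X$ over type variables, $Y$ over qualifier variables). - Qualifiers: $P,Q,R ::= \top \mid \bot \mid Y \mid x \mid Q\wedge R \mid Q\vee R$. - Simple types: $S ::= \top \mid X \mid (x:T_1)\to T_2 \mid \forall(X<:S).T \mid \forall(Y<:Q).T$; qualified types: $T,U ::= \{Q\}\,S$. In $(x:T_1)\to T_2$ the variable $x$ is bound in $T_2$, where it may occur as a qualifier. - Terms: $s,t,u ::= x \mid \lambda(x)_P.t \mid s\{Q\}(t) \mid \Lambda(X<:S)_P.t \mid s[S] \mid \Lambda(Y<:Q)_P.t \mid s[Q] \mid \mathsf{assert}\,Q\,s \mid \mathsf{upqual}\,Q\,s$. The binder of $\lambda(x)_P.t$ binds $x$ in $t$ both as a term variable and as a qualifier variable; $P$ is the tag of the abstraction and is outside the scope of its binder. Values $v$ are the three forms of abstraction; $v_P$ denotes a value with tag $P$,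 and $v_Q$ the same value with its tag replaced by $Q$. - Environments: $\Gamma ::= \varnothing \mid \Gamma,x:T \mid \Gamma,X<:S \mid \Gamma,Y<:Q$. All environments, types, qualifiers and terms are well scoped: each entry of an environment uses only variables bound to its left, and in every judgment all free variables are bound in the environment. $\mathrm{fv}(t)$ is the set of term variables that occur free in $t$ in term position (occurrences in qualifiers, tags and types do not count), and $\bigvee_{y\in\varnothing}y=\bot$. *Evaluation.* $\mathrm{eval}$ is the partial map from qualifiers to the lattice $\{\bot\sqsubset\top\}$ that interprets $\top,\bot,\wedge,\vee$ and is undefined on qualifiers containing variables. Reduction $\longrightarrow$ is generated by - $(\lambda(x)_P.t)\{Q\}(v)\longrightarrow t[x\mapsto v,\,x\mapsto Q]$ ($v$ replaces $x$ in term position, $Q$ replaces $x$ in qualifier position); - $(\Lambda(X<:S)_P.t)[S']\longrightarrow t[X\mapsto S']$; $\quad(\Lambda(Y<:Q)_P.t)[Q']\longrightarrow t[Y\mapsto Q']$; - $\mathsf{upqual}\,Q\,v_P\longrightarrow v_Q$ and $\mathsf{assert}\,Q\,v_P\longrightarrow v_P$, if $\mathrm{eval}(P)$ and $\mathrm{eval}(Q)$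 are defined and $\mathrm{eval}(P)\sqsubseteq\mathrm{eval}(Q)$; - $E[s]\longrightarrow E[t]$ if $s\longrightarrow t$, for $E ::= [\,] \mid E\{Q\}(t) \mid v\{Q\}(E) \mid E[S] \mid E[Q] \mid \mathsf{assert}\,Q\,E \mid \mathsf{upqual}\,Q\,E$. *Subqualification* $\Gamma\vdash Q<:R$ is generated by: $Q<:\top$; $\bot<:Q$; $Y<:Y$; $x<:x$; $Y<:R$ if $(Y<:Q)\in\Gamma$ and $Q<:R$; $x<:R$ if $(x:\{Q\}S)\in\Gamma$ and $Q<:R$; $Q<:R_1\vee R_2$ if $Q<:R_1$ or $Q<:R_2$; $Q_1\vee Q_2<:R$ if $Q_1<:R$ and $Q_2<:R$; $Q<:R_1\wedge R_2$ if $Q<:R_1$ and $Q<:R_2$; $Q_1\wedge Q_2<:R$ if $Q_1<:R$ or $Q_2<:R$. *Subtyping* is generated by: $\Gamma\vdash S<:\top$; $\Gamma\vdash X<:X$; $\Gamma\vdash X<:S'$ if $(X<:S)\in\Gamma$ and $\Gamma\vdash S<:S'$; $\Gamma\vdash (x:T_1)\to U_1<:(x:T_2)\to U_2$ if $\Gamma\vdash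 T_2<:T_1$ and $\Gamma,x:T_2\vdash U_1<:U_2$; $\Gamma\vdash\forall(X<:S_1).U_1<:\forall(X<:S_2).U_2$ if $\Gamma\vdash S_2<:S_1$ and $\Gamma,X<:S_2\vdash U_1<:U_2$; $\Gamma\vdash\forall(Y<:Q_1).U_1<:\forall(Y<:Q_2).U_2$ if $\Gamma\vdash Q_2<:Q_1$ and $\Gamma,Y<:Q_2\vdash U_1<:U_2$; $\Gamma\vdash\{Q_1\}S_1<:\{Q_2\}S_2$ if $\Gamma\vdash Q_1<:Q_2$ and $\Gamma\vdash S_1<:S_2$. *Typing* $\Gamma\vdash t:T$ is generated by: - $\Gamma\vdash x:\{x\}S$ if $(x:\{Q\}S)\in\Gamma$; - $\Gamma\vdash\lambda(x)_P.t:\{P\}\,(x:T_1)\to T_2$ if $\Gamma,x:T_1\vdash t:T_2$ and $\Gamma\vdash\bigvee_{y\in\mathrm{fv}(t)\setminus\{x\}}y<:P$; - $\Gamma\vdash\Lambda(X<:S)_P.t:\{P\}\,\forall(X<:S).T$ if $\Gamma,X<:S\vdash t:T$ and $\Gamma\vdash\bigvee_{y\in\mathrm{fv}(t)}y<:P$;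 - $\Gamma\vdash\Lambda(Y<:Q)_P.t:\{P\}\,\forall(Y<:Q).T$ if $\Gamma,Y<:Q\vdash t:T$ and $\Gamma\vdash\bigvee_{y\in\mathrm{fv}(t)}y<:P$; - $\Gamma\vdash s\{Q'\}(t):T[x\mapsto Q']$ if $\Gamma\vdash s:\{R\}\,(x:\{Q\}S)\to T$, $\Gamma\vdash t:\{Q'\}S$ and $\Gamma\vdash Q'<:Q$; - $\Gamma\vdash s[S']:T[X\mapsto S']$ if $\Gamma\vdash s:\{R\}\,\forall(X<:S).T$ and $\Gamma\vdash S'<:S$; - $\Gamma\vdash s[Q']:T[Y\mapsto Q']$ if $\Gamma\vdash s:\{R\}\,\forall(Y<:Q).T$ and $\Gamma\vdash Q'<:Q$; - $\Gamma\vdash\mathsf{assert}\,P\,s:\{Q\}S$ and $\Gamma\vdash\mathsf{upqual}\,P\,s:\{P\}S$, each if $\Gamma\vdash s:\{Q\}S$ and $\Gamma\vdash Q<:P$; - $\Gamma\vdash s:T_2$ if $\Gamma\vdash s:T_1$ and $\Gamma\vdash T_1<:T_2$. -/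

import Mathlib

/-!
The capture-tracking calculus `F<:C`, in well-scoped de Bruijn form.  A *signature* lists the kinds
of the binders in scope (innermost first), and qualifiers, types, terms and environments are indexed
by it; well-formedness of types and environments (every variable is bound to the left of its use)
is therefore built into the syntax.
-/

namespace FsubC

/-- The three kinds of binders: `x : T`, `X <: S` and `Y <: Q`. -/
inductive Kind : Type
  | tm
  | ty
  | qu

abbrev Sig : Type := List Kind

/-- Variables of kind `k` in scope `s`. -/
inductive Var : Sig → Kind → Type
  | here {s : Sig} {k : Kind} : Var (k :: s) k
  | there {s : Sig} {k j : Kind} (x : Var s k) : Var (j :: s) k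

/-- Qualifiers `P, Q, R ::= ⊤ | ⊥ | Y | x | Q ∧ R | Q ∨ R`; a term binder `x` also binds a qualifier
variable of the same name. -/
inductive Qual (s : Sig) : Type
  | top
  | bot
  | qvar (Y : Var s .qu)
  | tvar (x : Var s .tm)
  | meet (Q R : Qual s)
  | join (Q R : Qual s)

inductive TySort : Type
  | simple
  | qualified

/-- Simple types `S ::= ⊤ | X | (x : T₁) → T₂ | ∀(X <: S). T | ∀(Y <: Q). T` and
qualified types `T ::= {Q} S`. In an arrow `(x : T₁) → T₂` the variable `x` may occur in `T₂`,
in qualifier position. -/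
inductive Ty : TySort → Sig → Type
  | top {s : Sig} : Ty .simple s
  | var {s : Sig} (X : Var s .ty) : Ty .simple s
  | arrow {s : Sig} (T₁ : Ty .qualified s) (T₂ : Ty .qualified (.tm :: s)) : Ty .simple s
  | all {s : Sig} (S : Ty .simple s) (T : Ty .qualified (.ty :: s)) : Ty .simple s
  | qall {s : Sig} (Q : Qual s) (T : Ty .qualified (.qu :: s)) : Ty .simple s
  | qtype {s : Sig} (Q : Qual s) (S : Ty .simple s) : Ty .qualified s

/-- Simple types `S`. -/
abbrev STy (s : Sig) : Type := Ty .simple s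

/-- Qualified types `T`. -/
abbrev QTy (s : Sig) : Type := Ty .qualified s

/-- Terms
`s, t ::= x | λ(x)_P. t | s{Q}(t) | Λ(X <: S)_P. t | s[S] | Λ(Y <: Q)_P. t | s[Q]
  | assert Q s | upqual Q s`,
where `P` is the tag of an abstraction. -/
inductive Tm : Sig → Type
  | var {s : Sig} (x : Var s .tm) : Tm s
  | lam {s : Sig} (P : Qual s) (t : Tm (.tm :: s)) : Tm s
  | app {s : Sig} (t : Tm s) (Q : Qual s) (u : Tm s) : Tm s
  | tlam {s : Sig} (P : Qual s) (S : STy s) (t : Tm (.ty :: s)) : Tm s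
  | tapp {s : Sig} (t : Tm s) (S : STy s) : Tm s
  | qlam {s : Sig} (P : Qual s) (Q : Qual s) (t : Tm (.qu :: s)) : Tm s
  | qapp {s : Sig} (t : Tm s) (Q : Qual s) : Tm s
  | assert {s : Sig} (Q : Qual s) (t : Tm s) : Tm s
  | upqual {s : Sig} (Q : Qual s) (t : Tm s) : Tm s

/-! ### Renaming -/

/-- Kind-preserving renamings. -/
abbrev Ren (s s' : Sig) : Type := (k : Kind) → Var s k → Var s' k

def Ren.weak {s : Sig} {j : Kind} : Ren s (j :: s) := fun _ x => .there x

def Ren.lift {s s' : Sig} {j : Kind} (ρ : Ren s s') : Ren (j :: s) (j :: s')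
  | _, .here => .here
  | _, .there x => .there (ρ _ x)

def Qual.rename {s s' : Sig} (ρ : Ren s s') : Qual s → Qual s'
  | .top => .top
  | .bot => .bot
  | .qvar Y => .qvar (ρ _ Y)
  | .tvar x => .tvar (ρ _ x)
  | .meet Q R => .meet (Q.rename ρ) (R.rename ρ)
  | .join Q R => .join (Q.rename ρ) (R.rename ρ)

def Ty.rename {k : TySort} {s s' : Sig} (ρ : Ren s s') : Ty k s → Ty k s'
  | .top => .top
  | .var X => .var (ρ _ X)
  | .arrow T₁ T₂ => .arrow (T₁.rename ρ) (T₂.rename ρ.lift)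
  | .all S T => .all (S.rename ρ) (T.rename ρ.lift)
  | .qall Q T => .qall (Q.rename ρ) (T.rename ρ.lift)
  | .qtype Q S => .qtype (Q.rename ρ) (S.rename ρ)

def Tm.rename {s s' : Sig} (ρ : Ren s s') : Tm s → Tm s'
  | .var x => .var (ρ _ x)
  | .lam P t => .lam (P.rename ρ) (t.rename ρ.lift)
  | .app t Q u => .app (t.rename ρ) (Q.rename ρ) (u.rename ρ)
  | .tlam P S t => .tlam (P.rename ρ) (S.rename ρ) (t.rename ρ.lift)
  | .tapp t S => .tapp (t.rename ρ) (S.rename ρ)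
  | .qlam P Q t => .qlam (P.rename ρ) (Q.rename ρ) (t.rename ρ.lift)
  | .qapp t Q => .qapp (t.rename ρ) (Q.rename ρ)
  | .assert Q t => .assert (Q.rename ρ) (t.rename ρ)
  | .upqual Q t => .upqual (Q.rename ρ) (t.rename ρ)

/-! ### Simultaneous capture-avoiding substitution -/

/-- A substitution for the variables that may occur in types: `qtm` gives the qualifier replacing a
term-bound variable in qualifier position. -/
structure TySubst (s s' : Sig) : Type where
  qtm : Var s .tm → Qual s'
  ty : Var s .ty → STy s'
  qu : Var s .qu → Qual s'

def TySubst.lift {s s' : Sig} {j : Kind} (σ : TySubst s s') : TySubst (j :: s) (j :: s') where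
  qtm x := match j, x with
    | _, .here => .tvar .here
    | _, .there x => (σ.qtm x).rename Ren.weak
  ty X := match j, X with
    | _, .here => .var .here
    | _, .there X => (σ.ty X).rename Ren.weak
  qu Y := match j, Y with
    | _, .here => .qvar .here
    | _, .there Y => (σ.qu Y).rename Ren.weak

def Qual.subst {s s' : Sig} (σ : TySubst s s') : Qual s → Qual s'
  | .top => .top
  | .bot => .bot
  | .qvar Y => σ.qu Y
  | .tvar x => σ.qtm x
  | .meet Q R => .meet (Q.subst σ) (R.subst σ)
  | .join Q R => .join (Q.subst σ) (R.subst σ)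

def Ty.subst {k : TySort} {s s' : Sig} (σ : TySubst s s') : Ty k s → Ty k s'
  | .top => .top
  | .var X => σ.ty X
  | .arrow T₁ T₂ => .arrow (T₁.subst σ) (T₂.subst σ.lift)
  | .all S T => .all (S.subst σ) (T.subst σ.lift)
  | .qall Q T => .qall (Q.subst σ) (T.subst σ.lift)
  | .qtype Q S => .qtype (Q.subst σ) (S.subst σ)

/-- The term component of a substitution: what replaces term variables in term position. -/
abbrev TmSubst (s s' : Sig) : Type := Var s .tm → Tm s'

def TmSubst.lift {s s' : Sig} {j : Kind} (τ : TmSubst s s') : TmSubst (j :: s) (j :: s') :=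
  fun x => match j, x with
    | _, .here => .var .here
    | _, .there x => (τ x).rename Ren.weak

def Tm.subst {s s' : Sig} (σ : TySubst s s') (τ : TmSubst s s') : Tm s → Tm s'
  | .var x => τ x
  | .lam P t => .lam (P.subst σ) (t.subst σ.lift τ.lift)
  | .app t Q u => .app (t.subst σ τ) (Q.subst σ) (u.subst σ τ)
  | .tlam P S t => .tlam (P.subst σ) (S.subst σ) (t.subst σ.lift τ.lift)
  | .tapp t S => .tapp (t.subst σ τ) (S.subst σ)
  | .qlam P Q t => .qlam (P.subst σ) (Q.subst σ) (t.subst σ.lift τ.lift)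
  | .qapp t Q => .qapp (t.subst σ τ) (Q.subst σ)
  | .assert Q t => .assert (Q.subst σ) (t.subst σ τ)
  | .upqual Q t => .upqual (Q.subst σ) (t.subst σ τ)

/-- `[x ↦ Q]` in qualifier position, for the innermost (term) binder `x`. -/
def TySubst.instTm {s : Sig} (Q : Qual s) : TySubst (.tm :: s) s where
  qtm
    | .here => Q
    | .there x => .tvar x
  ty
    | .there X => .var X
  qu
    | .there Y => .qvar Y

/-- `[X ↦ S]`, for the innermost (type) binder `X`. -/
def TySubst.instTy {s : Sig} (S : STy s) : TySubst (.ty :: s) s where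
  qtm
    | .there x => .tvar x
  ty
    | .here => S
    | .there X => .var X
  qu
    | .there Y => .qvar Y

/-- `[Y ↦ Q]`, for the innermost (qualifier) binder `Y`. -/
def TySubst.instQu {s : Sig} (Q : Qual s) : TySubst (.qu :: s) s where
  qtm
    | .there x => .tvar x
  ty
    | .there X => .var X
  qu
    | .here => Q
    | .there Y => .qvar Y

/-- `t[x ↦ v, x ↦ Q]`: the innermost term binder is replaced by `v` in term position and by `Q`
in qualifier position. -/
def Tm.instTm {s : Sig} (t : Tm (.tm :: s)) (Q : Qual s) (v : Tm s) : Tm s :=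
  t.subst (TySubst.instTm Q) fun
    | .here => v
    | .there x => .var x

/-- `t[X ↦ S]`. -/
def Tm.instTy {s : Sig} (t : Tm (.ty :: s)) (S : STy s) : Tm s :=
  t.subst (TySubst.instTy S) fun
    | .there x => .var x

/-- `t[Y ↦ Q]`. -/
def Tm.instQu {s : Sig} (t : Tm (.qu :: s)) (Q : Qual s) : Tm s :=
  t.subst (TySubst.instQu Q) fun
    | .there x => .var x

/-! ### Free variables -/

/-- Undo one weakening; `none` on the variable bound by the innermost binder. -/
def Var.lower {s : Sig} {j k : Kind} : Var (j :: s) k → Option (Var s k)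
  | .here => none
  | .there x => some x

/-- The free term variables of a term (those occurring in term position), listed with
repetitions. -/
def Tm.fv {s : Sig} : Tm s → List (Var s .tm)
  | .var x => [x]
  | .lam _ t => t.fv.filterMap Var.lower
  | .app t _ u => t.fv ++ u.fv
  | .tlam _ _ t => t.fv.filterMap Var.lower
  | .tapp t _ => t.fv
  | .qlam _ _ t => t.fv.filterMap Var.lower
  | .qapp t _ => t.fv
  | .assert _ t => t.fv
  | .upqual _ t => t.fv

/-- The qualifier `⋁_{y ∈ l} y`; the empty join is `⊥`. -/
def joinVars {s : Sig} : List (Var s .tm) → Qual s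
  | [] => .bot
  | x :: l => .join (.tvar x) (joinVars l)

/-! ### Evaluation -/

/-- Evaluation of a qualifier to an element of the two-point lattice (`⊥ = false < true = ⊤`);
undefined on a qualifier that contains variables. -/
def Qual.eval {s : Sig} : Qual s → Option Bool
  | .top => some true
  | .bot => some false
  | .qvar _ => none
  | .tvar _ => none
  | .meet Q R => do
      let a ← Q.eval
      let b ← R.eval
      return a ⊓ b
  | .join Q R => do
      let a ← Q.eval
      let b ← R.eval
      return a ⊔ b

/-- `eval P` and `eval Q` are both defined and `eval P ⊑ eval Q`. -/
def EvalLE {s : Sig} (P Q : Qual s) : Prop :=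
  ∃ a b : Bool, P.eval = some a ∧ Q.eval = some b ∧ a ≤ b

/-- `Value P v`: the term `v` is a value (an abstraction) with tag `P`. -/
inductive Value {s : Sig} : Qual s → Tm s → Prop
  | lam (P : Qual s) (t : Tm (.tm :: s)) : Value P (.lam P t)
  | tlam (P : Qual s) (S : STy s) (t : Tm (.ty :: s)) : Value P (.tlam P S t)
  | qlam (P Q : Qual s) (t : Tm (.qu :: s)) : Value P (.qlam P Q t)

/-- Replace the tag of a value by `Q` (the identity on other terms). -/
def Tm.retag {s : Sig} (Q : Qual s) : Tm s → Tm s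
  | .lam _ t => .lam Q t
  | .tlam _ S t => .tlam Q S t
  | .qlam _ R t => .qlam Q R t
  | t => t

/-- Call-by-value reduction `s ⟶ t`, closed under the evaluation contexts
`E ::= [] | E{Q}(t) | v{Q}(E) | E[S] | E[Q] | assert Q E | upqual Q E`. -/
inductive Step {s : Sig} : Tm s → Tm s → Prop
  | beta_v {P Q R : Qual s} {t : Tm (.tm :: s)} {v : Tm s} :
      Value R v → Step (.app (.lam P t) Q v) (t.instTm Q v)
  | beta_T {P : Qual s} {S S' : STy s} {t : Tm (.ty :: s)} :
      Step (.tapp (.tlam P S t) S') (t.instTy S')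
  | beta_Q {P Q Q' : Qual s} {t : Tm (.qu :: s)} :
      Step (.qapp (.qlam P Q t) Q') (t.instQu Q')
  | upqual {P Q : Qual s} {v : Tm s} :
      Value P v → EvalLE P Q → Step (.upqual Q v) (v.retag Q)
  | assert {P Q : Qual s} {v : Tm s} :
      Value P v → EvalLE P Q → Step (.assert Q v) v
  | app_fun {t t' : Tm s} {Q : Qual s} {u : Tm s} :
      Step t t' → Step (.app t Q u) (.app t' Q u)
  | app_arg {R : Qual s} {v : Tm s} {Q : Qual s} {u u' : Tm s} :
      Value R v → Step u u' → Step (.app v Q u) (.app v Q u')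
  | tapp {t t' : Tm s} {S : STy s} : Step t t' → Step (.tapp t S) (.tapp t' S)
  | qapp {t t' : Tm s} {Q : Qual s} : Step t t' → Step (.qapp t Q) (.qapp t' Q)
  | assert_ctx {t t' : Tm s} {Q : Qual s} : Step t t' → Step (.assert Q t) (.assert Q t')
  | upqual_ctx {t t' : Tm s} {Q : Qual s} : Step t t' → Step (.upqual Q t) (.upqual Q t')

/-! ### Environments -/

/-- What an environment records for a variable of each kind: `x : T`, `X <: S` or `Y <: Q`. -/
inductive Binding : Kind → Sig → Type
  | tm {s : Sig} (T : QTy s) : Binding .tm s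
  | ty {s : Sig} (S : STy s) : Binding .ty s
  | qu {s : Sig} (Q : Qual s) : Binding .qu s

def Binding.rename {k : Kind} {s s' : Sig} (ρ : Ren s s') : Binding k s → Binding k s'
  | .tm T => .tm (T.rename ρ)
  | .ty S => .ty (S.rename ρ)
  | .qu Q => .qu (Q.rename ρ)

/-- Environments `Γ ::= ∅ | Γ, x : T | Γ, X <: S | Γ, Y <: Q`. -/
inductive Ctx : Sig → Type
  | nil : Ctx []
  | cons {s : Sig} {k : Kind} (Γ : Ctx s) (b : Binding k s) : Ctx (k :: s)

def Ctx.lookup {s : Sig} {k : Kind} : Ctx s → Var s k → Binding k s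
  | .cons _ b, .here => b.rename Ren.weak
  | .cons Γ _, .there x => (Γ.lookup x).rename Ren.weak

/-! ### Subqualification, subtyping, typing -/

/-- Subqualification `Γ ⊢ Q <: R`. -/
inductive SubQual {s : Sig} (Γ : Ctx s) : Qual s → Qual s → Prop
  | top {Q : Qual s} : SubQual Γ Q .top
  | bot {Q : Qual s} : SubQual Γ .bot Q
  | refl_var {Y : Var s .qu} : SubQual Γ (.qvar Y) (.qvar Y)
  | var {Y : Var s .qu} {Q R : Qual s} :
      Γ.lookup Y = .qu Q → SubQual Γ Q R → SubQual Γ (.qvar Y) R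
  | refl_tvar {x : Var s .tm} : SubQual Γ (.tvar x) (.tvar x)
  | tvar {x : Var s .tm} {Q R : Qual s} {S : STy s} :
      Γ.lookup x = .tm (.qtype Q S) → SubQual Γ Q R → SubQual Γ (.tvar x) R
  | join_intro_1 {Q R₁ R₂ : Qual s} : SubQual Γ Q R₁ → SubQual Γ Q (.join R₁ R₂)
  | join_intro_2 {Q R₁ R₂ : Qual s} : SubQual Γ Q R₂ → SubQual Γ Q (.join R₁ R₂)
  | join_elim {Q₁ Q₂ R : Qual s} :
      SubQual Γ Q₁ R → SubQual Γ Q₂ R → SubQual Γ (.join Q₁ Q₂) R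
  | meet_intro {Q R₁ R₂ : Qual s} :
      SubQual Γ Q R₁ → SubQual Γ Q R₂ → SubQual Γ Q (.meet R₁ R₂)
  | meet_elim_1 {Q₁ Q₂ R : Qual s} : SubQual Γ Q₁ R → SubQual Γ (.meet Q₁ Q₂) R
  | meet_elim_2 {Q₁ Q₂ R : Qual s} : SubQual Γ Q₂ R → SubQual Γ (.meet Q₁ Q₂) R

/-- Subtyping `Γ ⊢ S₁ <: S₂` of simple types and `Γ ⊢ T₁ <: T₂` of qualified types. -/
inductive Sub : {s : Sig} → Ctx s → {k : TySort} → Ty k s → Ty k s → Prop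
  | top {s : Sig} {Γ : Ctx s} {S : STy s} : Sub Γ S .top
  | refl_var {s : Sig} {Γ : Ctx s} {X : Var s .ty} : Sub Γ (.var X) (.var X)
  | var {s : Sig} {Γ : Ctx s} {X : Var s .ty} {S S' : STy s} :
      Γ.lookup X = .ty S → Sub Γ S S' → Sub Γ (.var X) S'
  | arrow {s : Sig} {Γ : Ctx s} {T₁ T₂ : QTy s} {U₁ U₂ : QTy (.tm :: s)} :
      Sub Γ T₂ T₁ → Sub (Γ.cons (.tm T₂)) U₁ U₂ → Sub Γ (.arrow T₁ U₁) (.arrow T₂ U₂)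
  | all {s : Sig} {Γ : Ctx s} {S₁ S₂ : STy s} {U₁ U₂ : QTy (.ty :: s)} :
      Sub Γ S₂ S₁ → Sub (Γ.cons (.ty S₂)) U₁ U₂ → Sub Γ (.all S₁ U₁) (.all S₂ U₂)
  | qall {s : Sig} {Γ : Ctx s} {Q₁ Q₂ : Qual s} {U₁ U₂ : QTy (.qu :: s)} :
      SubQual Γ Q₂ Q₁ → Sub (Γ.cons (.qu Q₂)) U₁ U₂ → Sub Γ (.qall Q₁ U₁) (.qall Q₂ U₂)
  | qtype {s : Sig} {Γ : Ctx s} {Q₁ Q₂ : Qual s} {S₁ S₂ : STy s} :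
      SubQual Γ Q₁ Q₂ → Sub Γ S₁ S₂ → Sub Γ (.qtype Q₁ S₁) (.qtype Q₂ S₂)

/-- Typing `Γ ⊢ t : T`. The rules for abstractions check that the tag super-qualifies the join of
the free variables of the abstraction. -/
inductive HasType : {s : Sig} → Ctx s → Tm s → QTy s → Prop
  | var {s : Sig} {Γ : Ctx s} {x : Var s .tm} {Q : Qual s} {S : STy s} :
      Γ.lookup x = .tm (.qtype Q S) → HasType Γ (.var x) (.qtype (.tvar x) S)
  | abs {s : Sig} {Γ : Ctx s} {P : Qual s} {T₁ : QTy s} {t : Tm (.tm :: s)}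
      {T₂ : QTy (.tm :: s)} :
      HasType (Γ.cons (.tm T₁)) t T₂ →
      SubQual Γ (joinVars (Tm.lam P t).fv) P →
      HasType Γ (.lam P t) (.qtype P (.arrow T₁ T₂))
  | t_abs {s : Sig} {Γ : Ctx s} {P : Qual s} {S : STy s} {t : Tm (.ty :: s)}
      {T : QTy (.ty :: s)} :
      HasType (Γ.cons (.ty S)) t T →
      SubQual Γ (joinVars (Tm.tlam P S t).fv) P →
      HasType Γ (.tlam P S t) (.qtype P (.all S T))
  | q_abs {s : Sig} {Γ : Ctx s} {P Q : Qual s} {t : Tm (.qu :: s)} {T : QTy (.qu :: s)} :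
      HasType (Γ.cons (.qu Q)) t T →
      SubQual Γ (joinVars (Tm.qlam P Q t).fv) P →
      HasType Γ (.qlam P Q t) (.qtype P (.qall Q T))
  | app {s : Sig} {Γ : Ctx s} {t u : Tm s} {R Q Q' : Qual s} {S : STy s}
      {T : QTy (.tm :: s)} :
      HasType Γ t (.qtype R (.arrow (.qtype Q S) T)) →
      HasType Γ u (.qtype Q' S) →
      SubQual Γ Q' Q →
      HasType Γ (.app t Q' u) (T.subst (TySubst.instTm Q'))
  | t_app {s : Sig} {Γ : Ctx s} {t : Tm s} {R : Qual s} {S S' : STy s}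
      {T : QTy (.ty :: s)} :
      HasType Γ t (.qtype R (.all S T)) →
      Sub Γ S' S →
      HasType Γ (.tapp t S') (T.subst (TySubst.instTy S'))
  | q_app {s : Sig} {Γ : Ctx s} {t : Tm s} {R Q Q' : Qual s} {T : QTy (.qu :: s)} :
      HasType Γ t (.qtype R (.qall Q T)) →
      SubQual Γ Q' Q →
      HasType Γ (.qapp t Q') (T.subst (TySubst.instQu Q'))
  | assert {s : Sig} {Γ : Ctx s} {t : Tm s} {P Q : Qual s} {S : STy s} :
      HasType Γ t (.qtype Q S) → SubQual Γ Q P → HasType Γ (.assert P t) (.qtype Q S)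
  | upqual {s : Sig} {Γ : Ctx s} {t : Tm s} {P Q : Qual s} {S : STy s} :
      HasType Γ t (.qtype Q S) → SubQual Γ Q P → HasType Γ (.upqual P t) (.qtype P S)
  | sub {s : Sig} {Γ : Ctx s} {t : Tm s} {T T' : QTy s} :
      HasType Γ t T → Sub Γ T T' → HasType Γ t T'

end FsubC

/-!
Preservation is proved by induction on the typing derivation.  A β-step reduces to the lemma that
typing is stable under simultaneous substitution.  In that lemma the tag condition of an
abstraction survives because the term put for `x` has its free variables below the qualifier put
for `x`.  This holds for values, since the qualifier of a typed value is above its tag; that is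
where call-by-value is used.

The metatheory of subtyping has the usual circularity of `F<:`: transitivity needs narrowing of
bounds, and narrowing needs transitivity through the bound.  Narrowing is therefore an instance of
substitution by the identity, where a substitution is only asked to send each type variable to a
type all of whose potential supertypes include those of the bound (`PreSub`).  Transitivity then
follows by induction on the middle type.
-/

namespace FsubC

variable {s s' s'' : Sig} {j : Kind} {k : TySort}

/-! ### Substitution algebra -/

/-- The identity renaming. -/
def Ren.id : Ren s s := fun _ x => x

/-- Composition of renamings in diagrammatic order: first `ρ`, then `ρ'`. -/
def Ren.comp (ρ : Ren s s') (ρ' : Ren s' s'') : Ren s s'' := fun k x => ρ' k (ρ k x)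

/-- A renaming seen as a substitution. -/
def TySubst.ofRen (ρ : Ren s s') : TySubst s s' where
  qtm x := .tvar (ρ _ x)
  ty X := .var (ρ _ X)
  qu Y := .qvar (ρ _ Y)

/-- The identity substitution. -/
def TySubst.id : TySubst s s := .ofRen .id

/-- A renaming `ρ` followed by a substitution `σ`. -/
def TySubst.precomp (σ : TySubst s' s'') (ρ : Ren s s') : TySubst s s'' where
  qtm x := σ.qtm (ρ _ x)
  ty X := σ.ty (ρ _ X)
  qu Y := σ.qu (ρ _ Y)

/-- Composition of substitutions in diagrammatic order: first `σ`, then `σ'`. -/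
def TySubst.comp (σ : TySubst s s') (σ' : TySubst s' s'') : TySubst s s'' where
  qtm x := (σ.qtm x).subst σ'
  ty X := (σ.ty X).subst σ'
  qu Y := (σ.qu Y).subst σ'

attribute [ext] TySubst

theorem TySubst.lift_ofRen (ρ : Ren s s') : (ofRen ρ).lift (j := j) = ofRen ρ.lift := by
  ext x <;> cases x <;> rfl

theorem TySubst.lift_id : (id (s := s)).lift (j := j) = id := by
  ext x <;> cases x <;> rfl

theorem TySubst.lift_precomp (σ : TySubst s' s'') (ρ : Ren s s') :
    (σ.precomp ρ).lift (j := j) = σ.lift.precomp ρ.lift := by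
  ext x <;> cases x <;> rfl

theorem Qual.subst_id (Q : Qual s) : Q.subst .id = Q := by
  induction Q <;> simp_all [subst, TySubst.id, TySubst.ofRen, Ren.id]

theorem Qual.rename_eq_subst (Q : Qual s) (ρ : Ren s s') : Q.rename ρ = Q.subst (.ofRen ρ) := by
  induction Q <;> simp_all [rename, subst, TySubst.ofRen]

theorem Qual.rename_id (Q : Qual s) : Q.rename .id = Q :=
  (Q.rename_eq_subst _).trans Q.subst_id

theorem Qual.subst_rename (Q : Qual s) (ρ : Ren s s') (σ : TySubst s' s'') :
    (Q.rename ρ).subst σ = Q.subst (σ.precomp ρ) := by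
  induction Q <;> simp_all [rename, subst, TySubst.precomp]

theorem Qual.subst_subst (Q : Qual s) (σ : TySubst s s') (σ' : TySubst s' s'') :
    (Q.subst σ).subst σ' = Q.subst (σ.comp σ') := by
  induction Q <;> simp_all [subst, TySubst.comp]

theorem Qual.rename_rename (Q : Qual s) (ρ : Ren s s') (ρ' : Ren s' s'') :
    (Q.rename ρ).rename ρ' = Q.rename (ρ.comp ρ') := by
  rw [rename_eq_subst _ ρ', subst_rename, rename_eq_subst]
  rfl

theorem Ty.subst_id (T : Ty k s) : T.subst .id = T := by
  induction T with
  | var X => rfl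
  | _ => simp_all [subst, TySubst.lift_id, Qual.subst_id]

theorem Ty.rename_eq_subst (T : Ty k s) (ρ : Ren s s') : T.rename ρ = T.subst (.ofRen ρ) := by
  induction T generalizing s' with
  | var X => rfl
  | _ => simp_all [rename, subst, TySubst.lift_ofRen, Qual.rename_eq_subst]

theorem Ty.rename_id (T : Ty k s) : T.rename .id = T :=
  (T.rename_eq_subst _).trans T.subst_id

theorem Ty.subst_rename (T : Ty k s) (ρ : Ren s s') (σ : TySubst s' s'') :
    (T.rename ρ).subst σ = T.subst (σ.precomp ρ) := by
  induction T generalizing s' s'' with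
  | var X => rfl
  | _ => simp_all [rename, subst, TySubst.lift_precomp, Qual.subst_rename]

theorem Ty.rename_rename (T : Ty k s) (ρ : Ren s s') (ρ' : Ren s' s'') :
    (T.rename ρ).rename ρ' = T.rename (ρ.comp ρ') := by
  rw [rename_eq_subst _ ρ', subst_rename, rename_eq_subst]
  rfl

theorem Qual.rename_weak_rename_lift (Q : Qual s) (ρ : Ren s s') :
    (Q.rename (Ren.weak (j := j))).rename ρ.lift = (Q.rename ρ).rename Ren.weak := by
  simp only [rename_rename]
  rfl

theorem Ty.rename_weak_rename_lift (T : Ty k s) (ρ : Ren s s') :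
    (T.rename (Ren.weak (j := j))).rename ρ.lift = (T.rename ρ).rename Ren.weak := by
  simp only [rename_rename]
  rfl

theorem TySubst.lift_comp_ofRen (σ : TySubst s s') (ρ : Ren s' s'') :
    (σ.comp (ofRen ρ)).lift (j := j) = σ.lift.comp (ofRen ρ.lift) := by
  ext x <;> cases x <;>
    simp only [comp, lift, ← Qual.rename_eq_subst, ← Ty.rename_eq_subst,
      Qual.rename_weak_rename_lift, Ty.rename_weak_rename_lift] <;> rfl

theorem Qual.rename_subst (Q : Qual s) (σ : TySubst s s') (ρ : Ren s' s'') :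
    (Q.subst σ).rename ρ = Q.subst (σ.comp (.ofRen ρ)) := by
  rw [rename_eq_subst, subst_subst]

theorem Ty.rename_subst (T : Ty k s) (σ : TySubst s s') (ρ : Ren s' s'') :
    (T.subst σ).rename ρ = T.subst (σ.comp (.ofRen ρ)) := by
  induction T generalizing s' s'' with
  | var X => exact rename_eq_subst _ ρ
  | _ => simp_all [rename, subst, TySubst.lift_comp_ofRen, Qual.rename_subst]

theorem TySubst.lift_precomp_weak (σ : TySubst s s') :
    (σ.lift (j := j)).precomp Ren.weak = σ.comp (ofRen Ren.weak) := by
  ext x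
  · exact Qual.rename_eq_subst _ _
  · exact Ty.rename_eq_subst _ _
  · exact Qual.rename_eq_subst _ _

theorem Qual.rename_weak_subst_lift (Q : Qual s) (σ : TySubst s s') :
    (Q.rename (Ren.weak (j := j))).subst σ.lift = (Q.subst σ).rename Ren.weak := by
  rw [subst_rename, TySubst.lift_precomp_weak, rename_subst]

theorem Ty.rename_weak_subst_lift (T : Ty k s) (σ : TySubst s s') :
    (T.rename (Ren.weak (j := j))).subst σ.lift = (T.subst σ).rename Ren.weak := by
  rw [subst_rename, TySubst.lift_precomp_weak, rename_subst]

theorem TySubst.lift_comp (σ : TySubst s s') (σ' : TySubst s' s'') :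
    (σ.comp σ').lift (j := j) = σ.lift.comp σ'.lift := by
  ext x <;> cases x <;>
    first
      | rfl
      | exact (Qual.rename_weak_subst_lift _ _).symm
      | exact (Ty.rename_weak_subst_lift _ _).symm

theorem Ty.subst_subst (T : Ty k s) (σ : TySubst s s') (σ' : TySubst s' s'') :
    (T.subst σ).subst σ' = T.subst (σ.comp σ') := by
  induction T generalizing s' s'' with
  | var X => rfl
  | _ => simp_all [subst, TySubst.lift_comp, Qual.subst_subst]

theorem Qual.rename_weak_subst_of_precomp {σ : TySubst (j :: s) s} (hσ : σ.precomp Ren.weak = .id)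
    (Q : Qual s) : (Q.rename Ren.weak).subst σ = Q := by
  rw [subst_rename, hσ, subst_id]

theorem Ty.rename_weak_subst_of_precomp {σ : TySubst (j :: s) s} (hσ : σ.precomp Ren.weak = .id)
    (T : Ty k s) : (T.rename Ren.weak).subst σ = T := by
  rw [subst_rename, hσ, subst_id]

theorem TySubst.instTm_comp (Q : Qual s) (σ : TySubst s s') :
    (instTm Q).comp σ = σ.lift.comp (instTm (Q.subst σ)) := by
  ext x <;> cases x <;>
    first
      | rfl
      | exact (Qual.rename_weak_subst_of_precomp rfl _).symm
      | exact (Ty.rename_weak_subst_of_precomp rfl _).symm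

theorem TySubst.instTy_comp (S : STy s) (σ : TySubst s s') :
    (instTy S).comp σ = σ.lift.comp (instTy (S.subst σ)) := by
  ext x <;> cases x <;>
    first
      | rfl
      | exact (Qual.rename_weak_subst_of_precomp rfl _).symm
      | exact (Ty.rename_weak_subst_of_precomp rfl _).symm

theorem TySubst.instQu_comp (Q : Qual s) (σ : TySubst s s') :
    (instQu Q).comp σ = σ.lift.comp (instQu (Q.subst σ)) := by
  ext x <;> cases x <;>
    first
      | rfl
      | exact (Qual.rename_weak_subst_of_precomp rfl _).symm
      | exact (Ty.rename_weak_subst_of_precomp rfl _).symm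

theorem Ty.subst_instTm (T : Ty k (.tm :: s)) (Q : Qual s) (σ : TySubst s s') :
    (T.subst (.instTm Q)).subst σ = (T.subst σ.lift).subst (.instTm (Q.subst σ)) := by
  rw [subst_subst, subst_subst, TySubst.instTm_comp]

theorem Ty.subst_instTy (T : Ty k (.ty :: s)) (S : STy s) (σ : TySubst s s') :
    (T.subst (.instTy S)).subst σ = (T.subst σ.lift).subst (.instTy (S.subst σ)) := by
  rw [subst_subst, subst_subst, TySubst.instTy_comp]

theorem Ty.subst_instQu (T : Ty k (.qu :: s)) (Q : Qual s) (σ : TySubst s s') :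
    (T.subst (.instQu Q)).subst σ = (T.subst σ.lift).subst (.instQu (Q.subst σ)) := by
  rw [subst_subst, subst_subst, TySubst.instQu_comp]

theorem Ty.rename_instTm (T : Ty k (.tm :: s)) (Q : Qual s) (ρ : Ren s s') :
    (T.subst (.instTm Q)).rename ρ = (T.rename ρ.lift).subst (.instTm (Q.rename ρ)) := by
  simp only [rename_eq_subst, Qual.rename_eq_subst, ← TySubst.lift_ofRen, subst_instTm]

theorem Ty.rename_instTy (T : Ty k (.ty :: s)) (S : STy s) (ρ : Ren s s') :
    (T.subst (.instTy S)).rename ρ = (T.rename ρ.lift).subst (.instTy (S.rename ρ)) := by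
  simp only [rename_eq_subst, ← TySubst.lift_ofRen, subst_instTy]

theorem Ty.rename_instQu (T : Ty k (.qu :: s)) (Q : Qual s) (ρ : Ren s s') :
    (T.subst (.instQu Q)).rename ρ = (T.rename ρ.lift).subst (.instQu (Q.rename ρ)) := by
  simp only [rename_eq_subst, Qual.rename_eq_subst, ← TySubst.lift_ofRen, subst_instQu]

/-! ### Subqualification is a preorder -/

section Preorder

variable {Γ : Ctx s} {P Q R Q₁ Q₂ : Qual s}

theorem SubQual.refl (Q : Qual s) : SubQual Γ Q Q := by
  induction Q with
  | top => exact .top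
  | bot => exact .bot
  | qvar Y => exact .refl_var
  | tvar x => exact .refl_tvar
  | meet Q R ihQ ihR => exact .meet_intro (.meet_elim_1 ihQ) (.meet_elim_2 ihR)
  | join Q R ihQ ihR => exact .join_elim (.join_intro_1 ihQ) (.join_intro_2 ihR)

theorem SubQual.of_top (h : SubQual Γ .top R) : SubQual Γ P R := by
  generalize hQ : Qual.top = Q at h
  induction h with
  | top => exact .top
  | join_intro_1 _ ih => exact .join_intro_1 (ih hQ)
  | join_intro_2 _ ih => exact .join_intro_2 (ih hQ)
  | meet_intro _ _ ih₁ ih₂ => exact .meet_intro (ih₁ hQ) (ih₂ hQ)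
  | _ => cases hQ

theorem SubQual.join_left_iff :
    SubQual Γ (.join Q₁ Q₂) R ↔ SubQual Γ Q₁ R ∧ SubQual Γ Q₂ R := by
  refine ⟨fun h => ?_, fun h => .join_elim h.1 h.2⟩
  generalize hQ : Qual.join Q₁ Q₂ = Q at h
  induction h with
  | top => exact ⟨.top, .top⟩
  | join_intro_1 _ ih => exact ⟨.join_intro_1 (ih hQ).1, .join_intro_1 (ih hQ).2⟩
  | join_intro_2 _ ih => exact ⟨.join_intro_2 (ih hQ).1, .join_intro_2 (ih hQ).2⟩
  | meet_intro _ _ ih₁ ih₂ =>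
    exact ⟨.meet_intro (ih₁ hQ).1 (ih₂ hQ).1, .meet_intro (ih₁ hQ).2 (ih₂ hQ).2⟩
  | join_elim h₁ h₂ => cases hQ; exact ⟨h₁, h₂⟩
  | _ => cases hQ

/-- Stated in this form because `Q₁ ∧ Q₂ <: R` gives neither `Q₁ <: R` nor `Q₂ <: R`: the choice
between the two may come only after `R` has been decomposed. -/
theorem SubQual.meet_left_elim (h : SubQual Γ (.meet Q₁ Q₂) R)
    (h₁ : ∀ {R}, SubQual Γ Q₁ R → SubQual Γ P R) (h₂ : ∀ {R}, SubQual Γ Q₂ R → SubQual Γ P R) :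
    SubQual Γ P R := by
  generalize hQ : Qual.meet Q₁ Q₂ = Q at h
  induction h with
  | top => exact .top
  | join_intro_1 _ ih => exact .join_intro_1 (ih hQ)
  | join_intro_2 _ ih => exact .join_intro_2 (ih hQ)
  | meet_intro _ _ ih₁ ih₂ => exact .meet_intro (ih₁ hQ) (ih₂ hQ)
  | meet_elim_1 h => cases hQ; exact h₁ h
  | meet_elim_2 h => cases hQ; exact h₂ h
  | _ => cases hQ

theorem SubQual.trans (h₁ : SubQual Γ P Q) (h₂ : SubQual Γ Q R) : SubQual Γ P R := by
  induction h₁ generalizing R with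
  | top => exact h₂.of_top
  | bot => exact .bot
  | refl_var | refl_tvar => exact h₂
  | var hl _ ih => exact .var hl (ih h₂)
  | tvar hl _ ih => exact .tvar hl (ih h₂)
  | join_intro_1 _ ih => exact ih (join_left_iff.1 h₂).1
  | join_intro_2 _ ih => exact ih (join_left_iff.1 h₂).2
  | join_elim _ _ ih₁ ih₂ => exact .join_elim (ih₁ h₂) (ih₂ h₂)
  | meet_intro _ _ ih₁ ih₂ => exact h₂.meet_left_elim ih₁ ih₂
  | meet_elim_1 _ ih => exact .meet_elim_1 (ih h₂)
  | meet_elim_2 _ ih => exact .meet_elim_2 (ih h₂)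

theorem SubQual.joinVars_left_iff {l : List (Var s .tm)} :
    SubQual Γ (joinVars l) R ↔ ∀ x ∈ l, SubQual Γ (.tvar x) R := by
  induction l with
  | nil => simp [joinVars, SubQual.bot]
  | cons x l ih => rw [joinVars, join_left_iff, ih, List.forall_mem_cons]

theorem SubQual.joinVars_singleton (x : Var s .tm) : SubQual Γ (joinVars [x]) (.tvar x) :=
  .join_elim .refl_tvar .bot

end Preorder

/-! ### Renamings and substitutions between environments -/

/-- Substitution in an environment entry. -/
def Binding.subst (σ : TySubst s s') : Binding j s → Binding j s'
  | .tm T => .tm (T.subst σ)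
  | .ty S => .ty (S.subst σ)
  | .qu Q => .qu (Q.subst σ)

theorem Binding.rename_id (b : Binding j s) : b.rename .id = b := by
  cases b <;> simp only [rename, Ty.rename_id, Qual.rename_id]

theorem Binding.rename_rename (b : Binding j s) (ρ : Ren s s') (ρ' : Ren s' s'') :
    (b.rename ρ).rename ρ' = b.rename (ρ.comp ρ') := by
  cases b <;> simp only [rename, Ty.rename_rename, Qual.rename_rename]

theorem Binding.rename_weak_rename_lift {i : Kind} (b : Binding i s) (ρ : Ren s s') :
    (b.rename (Ren.weak (j := j))).rename ρ.lift = (b.rename ρ).rename Ren.weak := by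
  simp only [rename_rename]
  rfl

/-- `ρ` sends each variable declared in `Γ` to one declared, up to `ρ`, in the same way in `Δ`. -/
def Ren.Typed (ρ : Ren s s') (Γ : Ctx s) (Δ : Ctx s') : Prop :=
  ∀ k (x : Var s k), Δ.lookup (ρ k x) = (Γ.lookup x).rename ρ

section RenTyped

variable {Γ : Ctx s} {Δ : Ctx s'} {Θ : Ctx s''} {ρ : Ren s s'} {ρ' : Ren s' s''}

theorem Ren.Typed.id (Γ : Ctx s) : Ren.id.Typed Γ Γ := fun _ _ => (Binding.rename_id _).symm

theorem Ren.Typed.weak (Γ : Ctx s) (b : Binding j s) : Ren.weak.Typed Γ (Γ.cons b) :=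
  fun _ _ => rfl

theorem Ren.Typed.comp (h : ρ.Typed Γ Δ) (h' : ρ'.Typed Δ Θ) : (ρ.comp ρ').Typed Γ Θ := by
  intro k x
  rw [← Binding.rename_rename, ← h k x]
  exact h' k (ρ k x)

theorem Ren.Typed.lift (h : ρ.Typed Γ Δ) (b : Binding j s) :
    ρ.lift.Typed (Γ.cons b) (Δ.cons (b.rename ρ)) := by
  intro k x
  cases x with
  | here => exact (Binding.rename_weak_rename_lift b ρ).symm
  | there x =>
    refine Eq.trans ?_ (Binding.rename_weak_rename_lift (Γ.lookup x) ρ).symm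
    exact congrArg _ (h k x)

end RenTyped

theorem Sub.refl {Γ : Ctx s} (T : Ty k s) : Sub Γ T T := by
  induction T with
  | top => exact .top
  | var X => exact .refl_var
  | arrow T U ihT ihU => exact .arrow ihT ihU
  | all S U ihS ihU => exact .all ihS ihU
  | qall Q U ihU => exact .qall (.refl Q) ihU
  | qtype Q S ihS => exact .qtype (.refl Q) ihS

/-- `A` is below every type that `B` is below, in every environment into which `Γ` can be renamed.
Once subtyping is known to be transitive this is just `Γ ⊢ A <: B`. -/
def PreSub (Γ : Ctx s) (A B : Ty k s) : Prop :=
  ∀ ⦃s' : Sig⦄ ⦃Δ : Ctx s'⦄ ⦃ρ : Ren s s'⦄, ρ.Typed Γ Δ →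
    ∀ ⦃U : Ty k s'⦄, Sub Δ (B.rename ρ) U → Sub Δ (A.rename ρ) U

section PreSub

variable {Γ : Ctx s} {Δ : Ctx s'} {A B : Ty k s}

theorem PreSub.sub (h : PreSub Γ A B) {U : Ty k s} (hU : Sub Γ B U) : Sub Γ A U := by
  simpa only [Ty.rename_id] using h (Ren.Typed.id Γ) (by rwa [Ty.rename_id])

theorem PreSub.rename (h : PreSub Γ A B) {ρ : Ren s s'} (hρ : ρ.Typed Γ Δ) :
    PreSub Δ (A.rename ρ) (B.rename ρ) := by
  intro s'' Θ ρ' hρ' U hU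
  rw [Ty.rename_rename] at hU ⊢
  exact h (hρ.comp hρ') hU

theorem PreSub.of_lookup {X : Var s .ty} {S : STy s} (hX : Γ.lookup X = .ty S) :
    PreSub Γ (.var X) S :=
  fun _ _ _ hρ _ hU => .var ((hρ _ X).trans (congrArg _ hX)) hU

end PreSub

/-- `σ` sends the variable `x` below the image of its bound, where `b` is the declaration of `x`;
for a type variable this is expressed with `PreSub`. -/
def TySubst.Respects (σ : TySubst s s') (Δ : Ctx s') {k : Kind} (x : Var s k) (b : Binding k s) :
    Prop :=
  match k, x, b with
  | _, x, .tm (.qtype Q _) => SubQual Δ (σ.qtm x) (Q.subst σ)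
  | _, X, .ty S => PreSub Δ (σ.ty X) (S.subst σ)
  | _, Y, .qu Q => SubQual Δ (σ.qu Y) (Q.subst σ)

/-- `σ` respects every declaration of `Γ`. -/
def TySubst.Typed (σ : TySubst s s') (Γ : Ctx s) (Δ : Ctx s') : Prop :=
  ∀ k (x : Var s k), σ.Respects Δ x (Γ.lookup x)

section SubstTyped

variable {Γ : Ctx s} {Δ : Ctx s'} {Θ : Ctx s''} {σ : TySubst s s'}

theorem TySubst.Typed.respects (h : σ.Typed Γ Δ) {x : Var s j} {b : Binding j s}
    (hx : Γ.lookup x = b) : σ.Respects Δ x b :=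
  hx ▸ h j x

theorem SubQual.subst {Q R : Qual s} (h : SubQual Γ Q R) (hσ : σ.Typed Γ Δ) :
    SubQual Δ (Q.subst σ) (R.subst σ) := by
  induction h with
  | top => exact .top
  | bot => exact .bot
  | refl_var | refl_tvar => exact .refl _
  | var hx _ ih | tvar hx _ ih => exact .trans (hσ.respects hx) ih
  | join_intro_1 _ ih => exact .join_intro_1 ih
  | join_intro_2 _ ih => exact .join_intro_2 ih
  | join_elim _ _ ih₁ ih₂ => exact .join_elim ih₁ ih₂
  | meet_intro _ _ ih₁ ih₂ => exact .meet_intro ih₁ ih₂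
  | meet_elim_1 _ ih => exact .meet_elim_1 ih
  | meet_elim_2 _ ih => exact .meet_elim_2 ih

theorem TySubst.respects_ofRen {ρ : Ren s s'} {x : Var s j} {b : Binding j s}
    (hx : Δ.lookup (ρ j x) = b.rename ρ) : (ofRen ρ).Respects Δ x b := by
  cases b with
  | tm T =>
    cases T with
    | qtype Q S =>
      refine SubQual.tvar hx ?_
      rw [Qual.rename_eq_subst]
      exact .refl _
  | ty S =>
    refine Eq.subst (motive := PreSub Δ _) (Ty.rename_eq_subst S ρ) ?_
    exact .of_lookup hx
  | qu Q =>
    refine SubQual.var hx ?_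
    rw [Qual.rename_eq_subst]
    exact .refl _

theorem Ren.Typed.ofRen {ρ : Ren s s'} (h : ρ.Typed Γ Δ) : (TySubst.ofRen ρ).Typed Γ Δ :=
  fun k x => TySubst.respects_ofRen (h k x)

theorem TySubst.Typed.id (Γ : Ctx s) : TySubst.id.Typed Γ Γ := (Ren.Typed.id Γ).ofRen

theorem SubQual.rename {Q R : Qual s} (h : SubQual Γ Q R) {ρ : Ren s s'} (hρ : ρ.Typed Γ Δ) :
    SubQual Δ (Q.rename ρ) (R.rename ρ) := by
  simpa only [Qual.rename_eq_subst] using h.subst hρ.ofRen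

theorem TySubst.Respects.rename {x : Var s j} {b : Binding j s} (h : σ.Respects Δ x b)
    {ρ : Ren s' s''} (hρ : ρ.Typed Δ Θ) : (σ.comp (.ofRen ρ)).Respects Θ x b := by
  cases b with
  | tm T =>
    cases T with
    | qtype Q S =>
      change SubQual Θ ((σ.qtm x).subst _) _
      rw [← Qual.rename_eq_subst, ← Qual.rename_subst]
      exact SubQual.rename h hρ
  | ty S =>
    change PreSub Θ ((σ.ty x).subst _) _
    rw [← Ty.rename_eq_subst, ← Ty.rename_subst]
    exact PreSub.rename h hρ
  | qu Q =>
    change SubQual Θ ((σ.qu x).subst _) _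
    rw [← Qual.rename_eq_subst, ← Qual.rename_subst]
    exact SubQual.rename h hρ

theorem TySubst.respects_rename_iff {σ : TySubst s' s''} {ρ : Ren s s'} {x : Var s j}
    {b : Binding j s} :
    σ.Respects Θ (ρ j x) (b.rename ρ) ↔ (σ.precomp ρ).Respects Θ x b := by
  cases b with
  | tm T =>
    cases T with
    | qtype Q S => exact iff_of_eq (congrArg (SubQual Θ _) (Q.subst_rename ρ σ))
  | ty S => exact iff_of_eq (congrArg (PreSub Θ _) (S.subst_rename ρ σ))
  | qu Q => exact iff_of_eq (congrArg (SubQual Θ _) (Q.subst_rename ρ σ))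

theorem TySubst.Typed.cons {σ : TySubst (j :: s) s'} {b : Binding j s}
    (htail : (σ.precomp Ren.weak).Typed Γ Δ) (hhead : σ.Respects Δ .here (b.rename Ren.weak)) :
    σ.Typed (Γ.cons b) Δ := by
  intro k x
  cases x with
  | here => exact hhead
  | there x => exact respects_rename_iff.2 (htail k x)

theorem TySubst.respects_lift_here (σ : TySubst s s') (Δ : Ctx s') (b : Binding j s) :
    σ.lift.Respects (Δ.cons (b.subst σ)) .here (b.rename Ren.weak) := by
  cases b with
  | tm T =>
    cases T with
    | qtype Q S =>
      refine SubQual.tvar rfl ?_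
      rw [Qual.rename_weak_subst_lift]
      exact .refl _
  | ty S => exact PreSub.of_lookup (congrArg _ (Ty.rename_weak_subst_lift S σ).symm)
  | qu Q =>
    refine SubQual.var rfl ?_
    rw [Qual.rename_weak_subst_lift]
    exact .refl _

theorem TySubst.Typed.lift (h : σ.Typed Γ Δ) (b : Binding j s) :
    σ.lift.Typed (Γ.cons b) (Δ.cons (b.subst σ)) := by
  refine .cons ?_ (respects_lift_here σ Δ b)
  rw [lift_precomp_weak]
  exact fun k x => (h k x).rename (.weak Δ _)

theorem Sub.subst {A B : Ty k s} (h : Sub Γ A B) (hσ : σ.Typed Γ Δ) :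
    Sub Δ (A.subst σ) (B.subst σ) := by
  induction h generalizing s' with
  | top => exact .top
  | refl_var => exact .refl _
  | var hX _ ih => exact PreSub.sub (hσ.respects hX) (ih hσ)
  | arrow _ _ ih₁ ih₂ => exact .arrow (ih₁ hσ) (ih₂ (hσ.lift _))
  | all _ _ ih₁ ih₂ => exact .all (ih₁ hσ) (ih₂ (hσ.lift _))
  | qall hQ _ ih => exact .qall (hQ.subst hσ) (ih (hσ.lift _))
  | qtype hQ _ ih => exact .qtype (hQ.subst hσ) (ih hσ)

theorem Sub.rename {A B : Ty k s} (h : Sub Γ A B) {ρ : Ren s s'} (hρ : ρ.Typed Γ Δ) :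
    Sub Δ (A.rename ρ) (B.rename ρ) := by
  simpa only [Ty.rename_eq_subst] using h.subst hρ.ofRen

end SubstTyped

/-! ### Narrowing and transitivity -/

section Transitivity

variable {Γ : Ctx s}

theorem Sub.narrow {b b' : Binding j s} {A B : Ty k (j :: s)} (h : Sub (Γ.cons b) A B)
    (hb : TySubst.id.Respects (Γ.cons b') .here (b.rename Ren.weak)) : Sub (Γ.cons b') A B := by
  have hid : TySubst.id.Typed (Γ.cons b) (Γ.cons b') := .cons (Ren.Typed.weak Γ b').ofRen hb
  simpa only [Ty.subst_id] using h.subst hid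

theorem Sub.narrow_tm {T₁ T₂ : QTy s} {A B : Ty k (.tm :: s)} (h : Sub (Γ.cons (.tm T₁)) A B)
    (hT : Sub Γ T₂ T₁) : Sub (Γ.cons (.tm T₂)) A B := by
  cases hT with
  | qtype hQ _ =>
    exact h.narrow (.tvar rfl ((Qual.subst_id _).symm ▸ hQ.rename (.weak Γ _)))

theorem Sub.narrow_ty {S₁ S₂ : STy s} {A B : Ty k (.ty :: s)} (h : Sub (Γ.cons (.ty S₁)) A B)
    (hS : PreSub Γ S₂ S₁) : Sub (Γ.cons (.ty S₂)) A B := by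
  refine h.narrow ?_
  intro s' Δ ρ hρ U hU
  rw [Ty.subst_id] at hU
  exact PreSub.of_lookup rfl hρ (hS.rename (.weak Γ _) hρ hU)

theorem Sub.narrow_qu {Q₁ Q₂ : Qual s} {A B : Ty k (.qu :: s)} (h : Sub (Γ.cons (.qu Q₁)) A B)
    (hQ : SubQual Γ Q₂ Q₁) : Sub (Γ.cons (.qu Q₂)) A B :=
  h.narrow (.var rfl ((Qual.subst_id _).symm ▸ hQ.rename (.weak Γ _)))

/-- Subtyping derivations whose last rule is not `Sub.var`, so that both sides have the same shape
or the right-hand side is `⊤`. -/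
inductive StructSub (Γ : Ctx s) : {k : TySort} → Ty k s → Ty k s → Prop
  | top {S : STy s} : StructSub Γ S .top
  | refl_var {X : Var s .ty} : StructSub Γ (.var X) (.var X)
  | arrow {T₁ T₂ : QTy s} {U₁ U₂ : QTy (.tm :: s)} :
      Sub Γ T₂ T₁ → Sub (Γ.cons (.tm T₂)) U₁ U₂ → StructSub Γ (.arrow T₁ U₁) (.arrow T₂ U₂)
  | all {S₁ S₂ : STy s} {U₁ U₂ : QTy (.ty :: s)} :
      Sub Γ S₂ S₁ → Sub (Γ.cons (.ty S₂)) U₁ U₂ → StructSub Γ (.all S₁ U₁) (.all S₂ U₂)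
  | qall {Q₁ Q₂ : Qual s} {U₁ U₂ : QTy (.qu :: s)} :
      SubQual Γ Q₂ Q₁ → Sub (Γ.cons (.qu Q₂)) U₁ U₂ → StructSub Γ (.qall Q₁ U₁) (.qall Q₂ U₂)
  | qtype {Q₁ Q₂ : Qual s} {S₁ S₂ : STy s} :
      SubQual Γ Q₁ Q₂ → Sub Γ S₁ S₂ → StructSub Γ (.qtype Q₁ S₁) (.qtype Q₂ S₂)

/-- A chain of `Sub.var` steps on the left of `A <: C` can be put back in front of any derivation
of `A' <: B`, so only the structural part of `A <: C` matters. -/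
theorem Sub.of_structSub {A B C : Ty k s} (h : Sub Γ A C)
    (hB : ∀ {A'}, StructSub Γ A' C → Sub Γ A' B) : Sub Γ A B := by
  induction h with
  | top => exact hB .top
  | refl_var => exact hB .refl_var
  | var hX _ ih => exact .var hX (ih hB)
  | arrow hT hU => exact hB (.arrow hT hU)
  | all hS hU => exact hB (.all hS hU)
  | qall hQ hU => exact hB (.qall hQ hU)
  | qtype hQ hS => exact hB (.qtype hQ hS)

/-- The renaming makes the induction hypothesis for the bound `S` of `∀(X <: S).T` strong enough to
give `PreSub`, which narrowing requires. -/
theorem Sub.trans_rename (T : Ty k s) {Δ : Ctx s'} (ρ : Ren s s') {A B : Ty k s'}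
    (hA : Sub Δ A (T.rename ρ)) (hB : Sub Δ (T.rename ρ) B) : Sub Δ A B := by
  induction T generalizing s' with
  | top => cases hB; exact .top
  | var X => exact hA.of_structSub fun | .refl_var => hB
  | arrow T U ihT ihU =>
    refine hA.of_structSub fun | .arrow hT hU => ?_
    cases hB with
    | top => exact .top
    | arrow hT' hU' => exact .arrow (ihT ρ hT' hT) (ihU ρ.lift (hU.narrow_tm hT') hU')
  | all S U ihS ihU =>
    refine hA.of_structSub fun | .all hS hU => ?_
    cases hB with
    | top => exact .top
    | @all _ _ _ S' _ _ hS' hU' =>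
      have hPre : PreSub Δ S' (S.rename ρ) := fun _ _ ρ' hρ' _ hV => by
        have hS'ρ := hS'.rename hρ'
        rw [Ty.rename_rename] at hS'ρ hV
        exact ihS (ρ.comp ρ') hS'ρ hV
      exact .all (ihS ρ hS' hS) (ihU ρ.lift (hU.narrow_ty hPre) hU')
  | qall Q U ihU =>
    refine hA.of_structSub fun | .qall hQ hU => ?_
    cases hB with
    | top => exact .top
    | qall hQ' hU' => exact .qall (hQ'.trans hQ) (ihU ρ.lift (hU.narrow_qu hQ') hU')
  | qtype Q S ihS =>
    refine hA.of_structSub fun | .qtype hQ hS => ?_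
    cases hB with
    | qtype hQ' hS' => exact .qtype (hQ.trans hQ') (ihS ρ hS hS')

theorem Sub.trans {A T B : Ty k s} (hA : Sub Γ A T) (hB : Sub Γ T B) : Sub Γ A B :=
  trans_rename T .id (by rwa [Ty.rename_id]) (by rwa [Ty.rename_id])

theorem Sub.preSub {A B : Ty k s} (h : Sub Γ A B) : PreSub Γ A B :=
  fun _ _ _ hρ _ hU => (h.rename hρ).trans hU

end Transitivity

/-! ### Instantiation of the innermost binder -/

section Instantiation

variable {Γ : Ctx s}

theorem TySubst.Typed.instTm {Q Q' : Qual s} (S : STy s) (h : SubQual Γ Q' Q) :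
    (instTm Q').Typed (Γ.cons (.tm (.qtype Q S))) Γ := by
  refine .cons (.id Γ) ?_
  change SubQual Γ Q' ((Q.rename Ren.weak).subst (.instTm Q'))
  rw [Qual.rename_weak_subst_of_precomp rfl]
  exact h

theorem TySubst.Typed.instTy {S S' : STy s} (h : Sub Γ S' S) :
    (instTy S').Typed (Γ.cons (.ty S)) Γ := by
  refine .cons (.id Γ) ?_
  change PreSub Γ S' ((S.rename Ren.weak).subst (.instTy S'))
  rw [Ty.rename_weak_subst_of_precomp rfl]
  exact h.preSub

theorem TySubst.Typed.instQu {Q Q' : Qual s} (h : SubQual Γ Q' Q) :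
    (instQu Q').Typed (Γ.cons (.qu Q)) Γ := by
  refine .cons (.id Γ) ?_
  change SubQual Γ Q' ((Q.rename Ren.weak).subst (.instQu Q'))
  rw [Qual.rename_weak_subst_of_precomp rfl]
  exact h

end Instantiation

/-! ### Free variables -/

theorem Var.lower_ren_lift (ρ : Ren s s') {i : Kind} (x : Var (j :: s) i) :
    (ρ.lift i x).lower = x.lower.map (ρ i) := by
  cases x <;> rfl

theorem Tm.filterMap_lower_fv_rename {t : Tm (j :: s)} {ρ : Ren s s'}
    (h : (t.rename ρ.lift).fv = t.fv.map (ρ.lift .tm)) :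
    (t.rename ρ.lift).fv.filterMap Var.lower = (t.fv.filterMap Var.lower).map (ρ .tm) := by
  rw [h, List.filterMap_map, List.map_filterMap]
  exact congrArg (List.filterMap · t.fv) (funext (Var.lower_ren_lift ρ))

theorem Tm.fv_rename (t : Tm s) (ρ : Ren s s') : (t.rename ρ).fv = t.fv.map (ρ .tm) := by
  induction t generalizing s' with
  | var x => rfl
  | lam _ _ ih | tlam _ _ _ ih | qlam _ _ _ ih => exact filterMap_lower_fv_rename (ih ρ.lift)
  | app _ _ _ iht ihu => simp only [rename, fv, iht, ihu, List.map_append]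
  | tapp _ _ ih | qapp _ _ ih | assert _ _ ih | upqual _ _ ih => exact ih ρ

theorem TmSubst.filterMap_lower_fv_lift (τ : TmSubst s s') (x : Var (j :: s) .tm) :
    (τ.lift x).fv.filterMap Var.lower = x.lower.toList.flatMap fun x => (τ x).fv := by
  cases x with
  | here => rfl
  | there x =>
    change ((τ x).rename Ren.weak).fv.filterMap Var.lower = [x].flatMap _
    rw [Tm.fv_rename, List.filterMap_map, List.flatMap_singleton]
    exact List.filterMap_some

theorem Tm.filterMap_lower_fv_subst {t : Tm (j :: s)} {σ : TySubst s s'} {τ : TmSubst s s'}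
    (h : (t.subst σ.lift τ.lift).fv = t.fv.flatMap fun x => (τ.lift x).fv) :
    (t.subst σ.lift τ.lift).fv.filterMap Var.lower =
      (t.fv.filterMap Var.lower).flatMap fun x => (τ x).fv := by
  rw [h, List.filterMap_flatMap, List.filterMap_eq_flatMap_toList, List.flatMap_assoc]
  simp only [TmSubst.filterMap_lower_fv_lift]

theorem Tm.fv_subst (t : Tm s) (σ : TySubst s s') (τ : TmSubst s s') :
    (t.subst σ τ).fv = t.fv.flatMap fun x => (τ x).fv := by
  induction t generalizing s' with
  | var x => simp only [subst, fv, List.flatMap_singleton]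
  | lam _ _ ih | tlam _ _ _ ih | qlam _ _ _ ih =>
    exact filterMap_lower_fv_subst (ih σ.lift τ.lift)
  | app _ _ _ iht ihu => simp only [subst, fv, iht, ihu, List.flatMap_append]
  | tapp _ _ ih | qapp _ _ ih | assert _ _ ih | upqual _ _ ih => exact ih σ τ

/-! ### Typing is stable under renaming and substitution -/

section TmSubstTyped

variable {Γ : Ctx s} {Δ : Ctx s'} {Θ : Ctx s''}

theorem SubQual.joinVars_fv_rename {t : Tm s} {P : Qual s} (h : SubQual Γ (joinVars t.fv) P)
    {ρ : Ren s s'} (hρ : ρ.Typed Γ Δ) : SubQual Δ (joinVars (t.rename ρ).fv) (P.rename ρ) := by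
  rw [joinVars_left_iff] at h
  rw [Tm.fv_rename, joinVars_left_iff, List.forall_mem_map]
  exact fun x hx => (h x hx).rename hρ

theorem HasType.rename {t : Tm s} {T : QTy s} (h : HasType Γ t T) {ρ : Ren s s'}
    (hρ : ρ.Typed Γ Δ) : HasType Δ (t.rename ρ) (T.rename ρ) := by
  induction h generalizing s' with
  | var hx => exact .var ((hρ _ _).trans (congrArg _ hx))
  | abs _ hP ih => exact .abs (ih (hρ.lift _)) (hP.joinVars_fv_rename hρ)
  | t_abs _ hP ih => exact .t_abs (ih (hρ.lift _)) (hP.joinVars_fv_rename hρ)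
  | q_abs _ hP ih => exact .q_abs (ih (hρ.lift _)) (hP.joinVars_fv_rename hρ)
  | app _ _ hQ iht ihu =>
    rw [Ty.rename_instTm]
    exact .app (iht hρ) (ihu hρ) (hQ.rename hρ)
  | t_app _ hS ih =>
    rw [Ty.rename_instTy]
    exact .t_app (ih hρ) (hS.rename hρ)
  | q_app _ hQ ih =>
    rw [Ty.rename_instQu]
    exact .q_app (ih hρ) (hQ.rename hρ)
  | assert _ hQ ih => exact .assert (ih hρ) (hQ.rename hρ)
  | upqual _ hQ ih => exact .upqual (ih hρ) (hQ.rename hρ)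
  | sub _ hT ih => exact .sub (ih hρ) (hT.rename hρ)

/-- If `b` declares `x : {Q} S`, then `τ x` has type `S` qualified by the qualifier `σ x` put for
`x`, and `σ x` is above the free variables of `τ x`.  No condition for the other two kinds. -/
def TmSubst.Respects (τ : TmSubst s s') (σ : TySubst s s') (Δ : Ctx s') {k : Kind} (x : Var s k)
    (b : Binding k s) : Prop :=
  match k, x, b with
  | _, x, .tm (.qtype _ S) =>
    HasType Δ (τ x) (.qtype (σ.qtm x) (S.subst σ)) ∧ SubQual Δ (joinVars (τ x).fv) (σ.qtm x)
  | _, _, _ => True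

/-- `τ`, together with `σ`, respects every declaration of `Γ`. -/
def TmSubst.Typed (τ : TmSubst s s') (σ : TySubst s s') (Γ : Ctx s) (Δ : Ctx s') : Prop :=
  ∀ k (x : Var s k), τ.Respects σ Δ x (Γ.lookup x)

variable {σ : TySubst s s'} {τ : TmSubst s s'}

theorem TmSubst.Typed.hasType (h : τ.Typed σ Γ Δ) {x : Var s .tm} {Q : Qual s} {S : STy s}
    (hx : Γ.lookup x = .tm (.qtype Q S)) : HasType Δ (τ x) (.qtype (σ.qtm x) (S.subst σ)) := by
  have hτx := h _ x
  rw [hx] at hτx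
  exact hτx.1

theorem TmSubst.Typed.fv (h : τ.Typed σ Γ Δ) (x : Var s .tm) :
    SubQual Δ (joinVars (τ x).fv) (σ.qtm x) := by
  have hτx := h _ x
  cases hb : Γ.lookup x with
  | tm T =>
    cases T
    rw [hb] at hτx
    exact hτx.2

theorem TmSubst.respects_var {x : Var s j} {b : Binding j s} (hx : Γ.lookup x = b) :
    TmSubst.Respects .var .id Γ x b := by
  cases b with
  | tm T =>
    cases T with
    | qtype Q S => exact ⟨S.subst_id.symm ▸ .var hx, .joinVars_singleton x⟩
  | ty | qu => trivial

theorem TmSubst.Typed.var (Γ : Ctx s) : TmSubst.Typed .var .id Γ Γ := fun _ _ => respects_var rfl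

theorem TmSubst.Respects.rename {x : Var s j} {b : Binding j s} (h : τ.Respects σ Δ x b)
    {ρ : Ren s' s''} (hρ : ρ.Typed Δ Θ) :
    TmSubst.Respects (fun y => (τ y).rename ρ) (σ.comp (.ofRen ρ)) Θ x b := by
  cases b with
  | tm T =>
    cases T with
    | qtype Q S =>
      change HasType Θ _ (.qtype ((σ.qtm x).subst _) _) ∧ SubQual Θ _ ((σ.qtm x).subst _)
      rw [← Qual.rename_eq_subst, ← Ty.rename_subst]
      exact ⟨h.1.rename hρ, h.2.joinVars_fv_rename hρ⟩
  | ty | qu => trivial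

theorem TmSubst.Typed.cons {τ : TmSubst (j :: s) s'} {σ : TySubst (j :: s) s'} {b : Binding j s}
    (htail : TmSubst.Typed (fun x => τ (.there x)) (σ.precomp Ren.weak) Γ Δ)
    (hhead : τ.Respects σ Δ .here (b.rename Ren.weak)) : τ.Typed σ (Γ.cons b) Δ := by
  intro k x
  cases x with
  | here => exact hhead
  | there x =>
    have hx := htail k x
    change τ.Respects σ Δ (.there x) ((Γ.lookup x).rename Ren.weak)
    cases hb : Γ.lookup x with
    | tm T =>
      cases T with
      | qtype Q S =>
        rw [hb] at hx
        exact ⟨(S.subst_rename Ren.weak σ).symm ▸ hx.1, hx.2⟩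
    | ty | qu => trivial

theorem TmSubst.respects_lift_here (τ : TmSubst s s') (σ : TySubst s s') (Δ : Ctx s')
    (b : Binding j s) :
    τ.lift.Respects σ.lift (Δ.cons (b.subst σ)) .here (b.rename Ren.weak) := by
  cases b with
  | tm T =>
    cases T with
    | qtype Q S =>
      exact ⟨(S.rename_weak_subst_lift σ).symm ▸ .var rfl, .joinVars_singleton _⟩
  | ty | qu => trivial

theorem TmSubst.Typed.lift (h : τ.Typed σ Γ Δ) (b : Binding j s) :
    τ.lift.Typed σ.lift (Γ.cons b) (Δ.cons (b.subst σ)) := by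
  refine .cons ?_ (respects_lift_here τ σ Δ b)
  rw [TySubst.lift_precomp_weak]
  exact fun k x => (h k x).rename (.weak Δ _)

theorem SubQual.joinVars_fv_subst {t : Tm s} {P : Qual s} (h : SubQual Γ (joinVars t.fv) P)
    (hσ : σ.Typed Γ Δ) (hτ : τ.Typed σ Γ Δ) :
    SubQual Δ (joinVars (t.subst σ τ).fv) (P.subst σ) := by
  rw [joinVars_left_iff] at h
  rw [Tm.fv_subst, joinVars_left_iff, List.forall_mem_flatMap]
  exact fun x hx => joinVars_left_iff.1 ((hτ.fv x).trans ((h x hx).subst hσ))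

theorem HasType.subst {t : Tm s} {T : QTy s} (h : HasType Γ t T) (hσ : σ.Typed Γ Δ)
    (hτ : τ.Typed σ Γ Δ) : HasType Δ (t.subst σ τ) (T.subst σ) := by
  induction h generalizing s' with
  | var hx => exact hτ.hasType hx
  | abs _ hP ih => exact .abs (ih (hσ.lift _) (hτ.lift _)) (hP.joinVars_fv_subst hσ hτ)
  | t_abs _ hP ih => exact .t_abs (ih (hσ.lift _) (hτ.lift _)) (hP.joinVars_fv_subst hσ hτ)
  | q_abs _ hP ih => exact .q_abs (ih (hσ.lift _) (hτ.lift _)) (hP.joinVars_fv_subst hσ hτ)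
  | app _ _ hQ iht ihu =>
    rw [Ty.subst_instTm]
    exact .app (iht hσ hτ) (ihu hσ hτ) (hQ.subst hσ)
  | t_app _ hS ih =>
    rw [Ty.subst_instTy]
    exact .t_app (ih hσ hτ) (hS.subst hσ)
  | q_app _ hQ ih =>
    rw [Ty.subst_instQu]
    exact .q_app (ih hσ hτ) (hQ.subst hσ)
  | assert _ hQ ih => exact .assert (ih hσ hτ) (hQ.subst hσ)
  | upqual _ hQ ih => exact .upqual (ih hσ hτ) (hQ.subst hσ)
  | sub _ hT ih => exact .sub (ih hσ hτ) (hT.subst hσ)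

end TmSubstTyped

section Instantiation

variable {Γ : Ctx s}

theorem HasType.instTm {t : Tm (.tm :: s)} {v : Tm s} {Q Q' : Qual s} {S : STy s}
    {T : QTy (.tm :: s)} (ht : HasType (Γ.cons (.tm (.qtype Q S))) t T)
    (hv : HasType Γ v (.qtype Q' S)) (hfv : SubQual Γ (joinVars v.fv) Q') (hQ : SubQual Γ Q' Q) :
    HasType Γ (t.instTm Q' v) (T.subst (.instTm Q')) := by
  refine ht.subst (.instTm S hQ) (.cons (.var Γ) ⟨?_, hfv⟩)
  rwa [Ty.rename_weak_subst_of_precomp rfl]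

theorem HasType.instTy {t : Tm (.ty :: s)} {S S' : STy s} {T : QTy (.ty :: s)}
    (ht : HasType (Γ.cons (.ty S)) t T) (hS : Sub Γ S' S) :
    HasType Γ (t.instTy S') (T.subst (.instTy S')) :=
  ht.subst (.instTy hS) (.cons (.var Γ) trivial)

theorem HasType.instQu {t : Tm (.qu :: s)} {Q Q' : Qual s} {T : QTy (.qu :: s)}
    (ht : HasType (Γ.cons (.qu Q)) t T) (hQ : SubQual Γ Q' Q) :
    HasType Γ (t.instQu Q') (T.subst (.instQu Q')) :=
  ht.subst (.instQu hQ) (.cons (.var Γ) trivial)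

end Instantiation

/-! ### Inversion of typing for values -/

section Values

variable {Γ : Ctx s} {P P' Q Q' R : Qual s} {S S' : STy s} {v : Tm s}

theorem HasType.lam_inv {t : Tm (.tm :: s)} (h : HasType Γ (.lam P t) (.qtype R S)) :
    ∃ T₁ T₂, HasType (Γ.cons (.tm T₁)) t T₂ ∧ SubQual Γ (joinVars (Tm.lam P t).fv) R ∧
      Sub Γ (.arrow T₁ T₂) S := by
  generalize hu : Tm.lam P t = u, hT : Ty.qtype R S = T at h
  induction h with
  | abs ht hP => cases hu; cases hT; exact ⟨_, _, ht, hP, .refl _⟩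
  | sub _ hsub ih =>
    cases hT
    cases hsub with
    | qtype hQ hS =>
      obtain ⟨T₁, T₂, ht, hP, hS'⟩ := ih hu rfl
      exact ⟨T₁, T₂, ht, hP.trans hQ, hS'.trans hS⟩
  | _ => cases hu

theorem HasType.tlam_inv {t : Tm (.ty :: s)} (h : HasType Γ (.tlam P S' t) (.qtype R S)) :
    ∃ T, HasType (Γ.cons (.ty S')) t T ∧ SubQual Γ (joinVars (Tm.tlam P S' t).fv) R ∧
      Sub Γ (.all S' T) S := by
  generalize hu : Tm.tlam P S' t = u, hT : Ty.qtype R S = T at h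
  induction h with
  | t_abs ht hP => cases hu; cases hT; exact ⟨_, ht, hP, .refl _⟩
  | sub _ hsub ih =>
    cases hT
    cases hsub with
    | qtype hQ hS =>
      obtain ⟨T, ht, hP, hS'⟩ := ih hu rfl
      exact ⟨T, ht, hP.trans hQ, hS'.trans hS⟩
  | _ => cases hu

theorem HasType.qlam_inv {t : Tm (.qu :: s)} (h : HasType Γ (.qlam P Q t) (.qtype R S)) :
    ∃ T, HasType (Γ.cons (.qu Q)) t T ∧ SubQual Γ (joinVars (Tm.qlam P Q t).fv) R ∧
      Sub Γ (.qall Q T) S := by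
  generalize hu : Tm.qlam P Q t = u, hT : Ty.qtype R S = T at h
  induction h with
  | q_abs ht hP => cases hu; cases hT; exact ⟨_, ht, hP, .refl _⟩
  | sub _ hsub ih =>
    cases hT
    cases hsub with
    | qtype hQ hS =>
      obtain ⟨T, ht, hP, hS'⟩ := ih hu rfl
      exact ⟨T, ht, hP.trans hQ, hS'.trans hS⟩
  | _ => cases hu

theorem HasType.value_fv (h : HasType Γ v (.qtype Q S)) (hv : Value P v) :
    SubQual Γ (joinVars v.fv) Q := by
  cases hv with
  | lam => obtain ⟨_, _, _, hfv, _⟩ := h.lam_inv; exact hfv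
  | tlam => obtain ⟨_, _, hfv, _⟩ := h.tlam_inv; exact hfv
  | qlam => obtain ⟨_, _, hfv, _⟩ := h.qlam_inv; exact hfv

theorem HasType.retag (h : HasType Γ v (.qtype Q S)) (hv : Value P v) (hR : SubQual Γ Q R) :
    HasType Γ (v.retag R) (.qtype R S) := by
  have hfv := (h.value_fv hv).trans hR
  cases hv with
  | lam =>
    obtain ⟨_, _, ht, _, hS⟩ := h.lam_inv
    exact .sub (.abs ht hfv) (.qtype (.refl R) hS)
  | tlam =>
    obtain ⟨_, ht, _, hS⟩ := h.tlam_inv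
    exact .sub (.t_abs ht hfv) (.qtype (.refl R) hS)
  | qlam =>
    obtain ⟨_, ht, _, hS⟩ := h.qlam_inv
    exact .sub (.q_abs ht hfv) (.qtype (.refl R) hS)

theorem HasType.beta_lam {t : Tm (.tm :: s)} {T : QTy (.tm :: s)}
    (ht : HasType Γ (.lam P t) (.qtype R (.arrow (.qtype Q S) T)))
    (hu : HasType Γ v (.qtype Q' S)) (hv : Value P' v) (hQ : SubQual Γ Q' Q) :
    HasType Γ (t.instTm Q' v) (T.subst (.instTm Q')) := by
  obtain ⟨T₁, T₂, hbody, _, hsub⟩ := ht.lam_inv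
  cases hsub with
  | arrow hdom hcod =>
    cases hdom with
    | qtype hQ₁ hS₁ =>
      have hu₁ := hu.sub (.qtype (.refl Q') hS₁)
      exact .sub (hbody.instTm hu₁ (hu.value_fv hv) (hQ.trans hQ₁)) (hcod.subst (.instTm S hQ))

theorem HasType.beta_tlam {U : STy s} {t : Tm (.ty :: s)} {T : QTy (.ty :: s)}
    (ht : HasType Γ (.tlam P U t) (.qtype R (.all S T))) (hS : Sub Γ S' S) :
    HasType Γ (t.instTy S') (T.subst (.instTy S')) := by
  obtain ⟨T₂, hbody, _, hsub⟩ := ht.tlam_inv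
  cases hsub with
  | all hbound hcod =>
    exact .sub (hbody.instTy (hS.trans hbound)) (hcod.subst (.instTy hS))

theorem HasType.beta_qlam {U : Qual s} {t : Tm (.qu :: s)} {T : QTy (.qu :: s)}
    (ht : HasType Γ (.qlam P U t) (.qtype R (.qall Q T))) (hQ : SubQual Γ Q' Q) :
    HasType Γ (t.instQu Q') (T.subst (.instQu Q')) := by
  obtain ⟨T₂, hbody, _, hsub⟩ := ht.qlam_inv
  cases hsub with
  | qall hbound hcod =>
    exact .sub (hbody.instQu (hQ.trans hbound)) (hcod.subst (.instQu hQ))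

end Values

end FsubC

theorem mainTheorem9 {σ : FsubC.Sig} (Γ : FsubC.Ctx σ) (s t : FsubC.Tm σ) (T : FsubC.QTy σ)
    (hs : FsubC.HasType Γ s T) (hst : FsubC.Step s t) : FsubC.HasType Γ t T := by
  induction hs with
  | var | abs | t_abs | q_abs => cases hst
  | app hs hu hQ ihs ihu =>
    cases hst with
    | beta_v hv => exact hs.beta_lam hu hv hQ
    | app_fun hst => exact .app (ihs _ hst) hu hQ
    | app_arg _ hst => exact .app hs (ihu _ hst) hQ
  | t_app hs hS ih =>
    cases hst with
    | beta_T => exact hs.beta_tlam hS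
    | tapp hst => exact .t_app (ih _ hst) hS
  | q_app hs hQ ih =>
    cases hst with
    | beta_Q => exact hs.beta_qlam hQ
    | qapp hst => exact .q_app (ih _ hst) hQ
  | assert hs hQ ih =>
    cases hst with
    | assert => exact hs
    | assert_ctx hst => exact .assert (ih _ hst) hQ
  | upqual hs hQ ih =>
    cases hst with
    | upqual hv => exact hs.retag hv hQ
    | upqual_ctx hst => exact .upqual (ih _ hst) hQ
  | sub _ hT ih => exact .sub (ih _ hst) hT
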